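/- Let $f\in\mathbb C[x_1,x_2,x_3]$ be one of the simple singularities $A_N$ ($N\ge1$): $\frac{x_1^{N+1}}{N+1}+\frac{x_2^2}2+\frac{x_3^2}2$; $D_N$ ($N\ge 4$): $x_1^2x_2-x_2^{N-1}+x_3^2$; $E_6$: $x_1^3+x_2^4+x_3^2$; $E_7$: $x_1^3+x_1x_2^3+x_3^2$; $E_8$: $x_1^3+x_2^5+x_3^2$ (with $N=6,7,8$ for $E_6,E_7,E_8$), with Coxeter number $h$ and the weights of $x_1,x_2,x_3$ normalized so that $\deg f=1$. Let $H=\mathbb C[x_1,x_2,x_3]/(f_{x_1},f_{x_2},f_{x_3})$ with the residue pairing, let $\psi_1,\dots,\psi_N$ be weighted-homogeneous polynomials, one of them equal to $1$, whose classes form a basis of $H$, let $m_a=1+h\deg\psi_a$, and let $\mu$ be the diagonal operator $\mu[\psi_a]=(\frac12-\frac{m_a}h)[\psi_a]$ on $H$. Let $f_\tau=f+\sum_a\tau^a\psi_a$, $\tau\in\mathbb C^N$. The tangent space at $\tau$ carries the product $\bullet$ of $\mathbb C[x]/(\partial f_\tau/\partial x)$ (via $\partial/\partial\tau^a\leftrightarrow\psi_a$)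 and the residue metric $(\partial_{\tau^a},\partial_{\tau^b})_\tau=(2\pi i)^{-3}\oint\oint\oint \psi_a\psi_b\,dx_1dx_2dx_3/\prod_i\partial_{x_i} f_\tau$. Let $(t^1,\dots,t^N)$ be weighted-homogeneous polynomial flat coordinates of this metric with $\deg t^a=\deg\tau^a=1-\deg\psi_a$ and $\partial t^a/\partial\tau^b=\delta_{ab}$ at $\tau=0$; they identify all tangent spaces with $H$ by $\partial/\partial t^a\leftrightarrow[\psi_a]$. Let $E=\sum_a(\deg\tau^a)\,\tau^a\,\partial/\partial\tau^a$, and let $L_E$ be the derivative along $E$ (entrywise on matrices in the flat basis or in the standard basis of $\mathbb C^N$). On an open set of semisimple points $\tau$, let $x^{(1)}(\tau),\dots,x^{(N)}(\tau)$ be the holomorphic branches of the distinct nondegenerate critical points of $f_\tau$, let $u^i=f_\tau(x^{(i)})$ be the canonical coordinates, $\Delta_i$ the Hessian determinants of $f_\tau$ at $x^{(i)}$, with holomorphic branches of $\sqrt{\Delta_i}$ chosen, and put $U=\operatorname{diag}(u^1,\dots,u^N)$ and $\Psi(q^1,\dots,q^N)=\sum_i q^i\sqrt{\Delta_i}\,\partial/\partial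 u^i\in H$. Let $R=1+R_1z+R_2z^2+\cdots$ be an $N\times N$ matrix series with coefficients holomorphic on this set such that $J=\Psi Re^{U/z}$ formally satisfies $z\partial_vJ=v\bullet J$ for all tangent vectors $v$, $(z\partial_z+L_E)R=0$, and $R(-z)^tR(z)=1$. At a given point $\tau$ of this set let $S=1+S_1z^{-1}+S_2z^{-2}+\cdots$, $S_k\in\operatorname{End}(H)$, be the gauge transformation with $S\,(\partial_z-\mu/z)\,S^{-1}=\partial_z-\mu/z+(E\bullet)/z^2$ and $S(-z)^*S(z)=1$, where $*$ is the adjoint with respect to the residue pairing. Then at $\tau$ the Virasoro operator $l_0=z\partial_z+\frac12-\mu$ on $H$-valued series and the formal product $M=S^{-1}\Psi Re^{U/z}$ satisfy $$M^{-1}l_0M=\sum_{i=1}^N({}^{A_1}l_0)^{(i)},$$ where ${}^{A_1}l_0=z\partial_z+\frac12$ is the Virasoro operator of the $A_1$-singularity and $({}^{A_1}l_0)^{(i)}$ is its action on the $i$-th component of $\mathbb C^N$-valued series. Here the left-hand side means the successive conjugation $e^{-U/z}\bigl(R^{-1}\bigl(\Psi^{-1}(S\,l_0\,S^{-1})\Psi\bigr)R\bigr)e^{U/z}$;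 it is part of the claim that each composition is well defined, i.e. that every matrix element of it, with respect to the powers of $z$, is a finite sum. -/

import Mathlib

noncomputable section

namespace SimpleSingularity

open MvPolynomial

/-! ## Simple singularities -/

/-- The types of simple singularities: `A_N` (`N ≥ 1`), `D_N` (`N ≥ 4`), `E_6`, `E_7`, `E_8`. -/
inductive ADE : Type
  | A (N : ℕ) (hN : 1 ≤ N) : ADE
  | D (N : ℕ) (hN : 4 ≤ N) : ADE
  | E6 : ADE
  | E7 : ADE
  | E8 : ADE

/-- The number `N` in the name of the type; it is the Milnor number of the singularity. -/
def ADE.rank : ADE → ℕ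
  | .A N _ => N
  | .D N _ => N
  | .E6 => 6
  | .E7 => 7
  | .E8 => 8

/-- The Coxeter number `h`. -/
def ADE.coxeter : ADE → ℚ
  | .A N _ => N + 1
  | .D N _ => 2 * (N - 1)
  | .E6 => 12
  | .E7 => 18
  | .E8 => 30

/-- The weights of `x₁, x₂, x₃`, normalized so that `f` has weight `1`. -/
def ADE.weight : ADE → Fin 3 → ℚ
  | .A N _ => ![1 / (N + 1), 1 / 2, 1 / 2]
  | .D N _ => ![(N - 2) / (2 * (N - 1)), 1 / (N - 1), 1 / 2]
  | .E6 => ![1 / 3, 1 / 4, 1 / 2]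
  | .E7 => ![1 / 3, 2 / 9, 1 / 2]
  | .E8 => ![1 / 3, 1 / 5, 1 / 2]

/-- The normal form `f` of the singularity. -/
def ADE.f : ADE → MvPolynomial (Fin 3) ℂ
  | .A N _ => C (1 / ((N : ℂ) + 1)) * X 0 ^ (N + 1) + C (1 / 2) * X 1 ^ 2 + C (1 / 2) * X 2 ^ 2
  | .D N _ => X 0 ^ 2 * X 1 - X 1 ^ (N - 1) + X 2 ^ 2
  | .E6 => X 0 ^ 3 + X 1 ^ 4 + X 2 ^ 2
  | .E7 => X 0 ^ 3 + X 0 * X 1 ^ 3 + X 2 ^ 2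
  | .E8 => X 0 ^ 3 + X 1 ^ 5 + X 2 ^ 2

/-- The ideal generated by the partial derivatives of a polynomial in three variables. -/
def jacobianIdeal (F : MvPolynomial (Fin 3) ℂ) : Ideal (MvPolynomial (Fin 3) ℂ) :=
  Ideal.span (Set.range fun i => pderiv i F)

/-- The algebra of functions on the critical scheme of `F`. For `F = f` it is the local algebra
`H` of the critical point. -/
abbrev MilnorAlgebra (F : MvPolynomial (Fin 3) ℂ) : Type :=
  MvPolynomial (Fin 3) ℂ ⧸ jacobianIdeal F

/-- `x` is a critical point of `F`. -/
def IsCriticalPoint (F : MvPolynomial (Fin 3) ℂ) (x : Fin 3 → ℂ) : Prop :=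
  ∀ i, eval x (pderiv i F) = 0

/-- The Hessian determinant of `F` at `x`. -/
def hessian (F : MvPolynomial (Fin 3) ℂ) (x : Fin 3 → ℂ) : ℂ :=
  Matrix.det (Matrix.of fun i j => eval x (pderiv i (pderiv j F)))

/-- The residue `(2πi)⁻³ ∮∮∮ g dx₁ dx₂ dx₃ / (F_{x₁} F_{x₂} F_{x₃})` over the cycle
`|F_{x₁}| = |F_{x₂}| = |F_{x₃}| = 1`. The integral is written in the coordinates `yᵢ = F_{xᵢ}`:
the cycle is a (possibly branched) cover of the torus `|yᵢ| = 1`, one sums over the points `x` of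
the cycle above `y`, and `dx₁ dx₂ dx₃ = dy₁ dy₂ dy₃ / Hess F`. The cycle encloses all the critical
points; the radius does not matter, since the sum over a full fibre of the gradient map extends to
an entire function of `y`. -/
def residue (F g : MvPolynomial (Fin 3) ℂ) : ℂ :=
  ((2 * Real.pi * Complex.I) ^ 3)⁻¹ *
    torusIntegral
      (fun y : Fin 3 → ℂ =>
        (∑ᶠ (x : Fin 3 → ℂ) (_ : ∀ i, eval x (pderiv i F) = y i), eval x g / hessian F x) /
          (y 0 * y 1 * y 2))
      0 (fun _ => 1)

/-! ## Miniversal deformation, residue metric, multiplication -/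

/-- The space of parameters `τ = (τ¹, …, τᴺ)` of the deformation, also used as the space of
tangent vectors at each of its points (components with respect to `∂/∂τᵃ`). -/
abbrev Param (T : ADE) : Type := Fin T.rank → ℂ

/-- `N × N` complex matrices. -/
abbrev Mat (N : ℕ) : Type := Matrix (Fin N) (Fin N) ℂ

/-- A choice of weighted-homogeneous polynomials `ψ_a`, one of them equal to `1`, whose classes
form a basis of the local algebra `H`. The local algebra is identified with `ℂᴺ` by means of this
basis, and operators on `H` are written as matrices in this basis. -/
structure HomogeneousBasis (T : ADE) where
  ψ : Fin T.rank → MvPolynomial (Fin 3) ℂ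
  deg : Fin T.rank → ℚ
  homogeneous : ∀ a, IsWeightedHomogeneous T.weight (ψ a) (deg a)
  exists_one : ∃ a, ψ a = 1
  linearIndependent :
    LinearIndependent ℂ fun a => (Ideal.Quotient.mk (jacobianIdeal T.f) (ψ a) : MilnorAlgebra T.f)
  span_eq_top :
    Submodule.span ℂ (Set.range fun a =>
      (Ideal.Quotient.mk (jacobianIdeal T.f) (ψ a) : MilnorAlgebra T.f)) = ⊤

variable {T : ADE}

namespace HomogeneousBasis

variable (D : HomogeneousBasis T)

/-- The polynomial `∑ vᵃ ψ_a` representing the tangent vector `∑ vᵃ ∂/∂τᵃ`, that is, the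
derivative of `f_τ` along it. -/
def tangentPoly (v : Param T) : MvPolynomial (Fin 3) ℂ := ∑ a, C (v a) * D.ψ a

/-- The miniversal deformation `f_τ = f + ∑ τᵃ ψ_a`. -/
def deformation (τ : Param T) : MvPolynomial (Fin 3) ℂ := T.f + D.tangentPoly τ

/-- The exponents `m_a = 1 + h deg ψ_a`. -/
def exponent (a : Fin T.rank) : ℚ := 1 + T.coxeter * D.deg a

/-- The diagonal operator `μ` on `H`, with eigenvalues `1/2 - m_a/h`. -/
def mu : Mat T.rank :=
  Matrix.diagonal fun a => ((1 / 2 - D.exponent a / T.coxeter : ℚ) : ℂ)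

/-- The weights `deg τᵃ = 1 - (m_a - 1)/h` of the parameters. -/
def paramDeg (a : Fin T.rank) : ℚ := 1 - (D.exponent a - 1) / T.coxeter

/-- The Euler vector field `E = ∑ (deg τᵃ) τᵃ ∂/∂τᵃ`. -/
def euler (τ : Param T) : Param T := fun a => (D.paramDeg a : ℂ) * τ a

/-- The Gram matrix of the residue metric at `τ` in the frame `∂/∂τᵃ`. At `τ = 0` this is the
residue pairing on `H` in the basis `[ψ_a]`. -/
def gram (τ : Param T) : Mat T.rank :=
  Matrix.of fun a b => residue (D.deformation τ) (D.ψ a * D.ψ b)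

end HomogeneousBasis

/-- The matrix `∂tᵃ/∂τᵇ` of a polynomial map `t` at `τ`. -/
def polyJacobian {N : ℕ} (t : Fin N → MvPolynomial (Fin N) ℂ) (τ : Fin N → ℂ) : Mat N :=
  Matrix.of fun a b => eval τ (pderiv b (t a))

/-- A weighted-homogeneous flat coordinate system `(t¹, …, tᴺ)` of the residue metric, normalized
by `∂/∂tᵃ = ∂/∂τᵃ` at `τ = 0`. Flatness: the Gram matrix in the frame `∂/∂tᵃ` does not depend on
`τ`, so that it equals the Gram matrix at `0`. The frame `∂/∂tᵃ` identifies each tangent space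
with the tangent space `H` at `τ = 0` by parallel transport: `∂/∂tᵃ` corresponds to `[ψ_a]`. -/
structure FlatCoordinates (D : HomogeneousBasis T) where
  t : Fin T.rank → MvPolynomial (Fin T.rank) ℂ
  homogeneous : ∀ a, IsWeightedHomogeneous D.paramDeg (t a) (D.paramDeg a)
  jacobian_zero : polyJacobian t 0 = 1
  isUnit_det : ∀ τ, IsUnit (polyJacobian t τ).det
  flat : ∀ τ, D.gram τ = (polyJacobian t τ).transpose * D.gram 0 * polyJacobian t τ

namespace FlatCoordinates

variable {D : HomogeneousBasis T} (F : FlatCoordinates D)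

/-- The tangent vector at `τ` (components with respect to `∂/∂τᵃ`) that corresponds to the
element of `H` with components `h` under the identification `∂/∂tᵃ ↔ [ψ_a]`. -/
def toTangent (τ : Param T) (h : Fin T.rank → ℂ) : Param T :=
  ((polyJacobian F.t τ)⁻¹).mulVec h

/-- `B` is the matrix of the operator `v•` on the tangent space at `τ`, identified with `H`. The
product on the tangent space is the product of the algebra `ℂ[x] / (∂f_τ/∂x)` under the
identification `∂/∂τᵃ ↔ ψ_a`. -/
def IsMulMatrix (τ v : Param T) (B : Mat T.rank) : Prop :=
  ∀ h : Fin T.rank → ℂ,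
    D.tangentPoly v * D.tangentPoly (F.toTangent τ h) - D.tangentPoly (F.toTangent τ (B.mulVec h))
      ∈ jacobianIdeal (D.deformation τ)

end FlatCoordinates

/-! ## Operators on vector-valued series in `z` and `z⁻¹` -/

/-- A linear operator on `ℂᴺ`-valued series in `z^{±1}`, given by its matrix elements: the
coefficient at `z^m` of the image of `w z^n` is `P m n w`. -/
abbrev FormalOp (N : ℕ) : Type := ℤ → ℤ → Mat N

namespace FormalOp

variable {N : ℕ}

/-- Only finitely many terms occur in each matrix element of the composition `K ∘ L`. -/
def Composable (K L : FormalOp N) : Prop := ∀ m n, {k : ℤ | K m k ≠ 0 ∧ L k n ≠ 0}.Finite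

/-- The composition `K ∘ L`; meaningful when `Composable K L` holds. -/
def comp (K L : FormalOp N) : FormalOp N := fun m n => ∑ᶠ k : ℤ, K m k * L k n

/-- Multiplication by a matrix that does not depend on `z`. -/
def const (A : Mat N) : FormalOp N := fun m n => if m = n then A else 0

/-- Multiplication by the series `∑_{k ≥ 0} G_k z^k`. -/
def mulPos (G : PowerSeries (Mat N)) : FormalOp N :=
  fun m n => if n ≤ m then PowerSeries.coeff (m - n).toNat G else 0

/-- Multiplication by the series `∑_{k ≥ 0} G_k z^{-k}`. -/
def mulNeg (G : PowerSeries (Mat N)) : FormalOp N :=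
  fun m n => if m ≤ n then PowerSeries.coeff (n - m).toNat G else 0

/-- The operator `∂_z - μ/z + B/z²`. -/
def connection (μ B : Mat N) : FormalOp N :=
  fun m n => if m = n - 1 then (n : ℂ) • (1 : Mat N) - μ else if m = n - 2 then B else 0

/-- The Virasoro operator `l₀ = z∂_z + 1/2 - μ`. -/
def virasoro (μ : Mat N) : FormalOp N :=
  fun m n => if m = n then ((n : ℂ) + 1 / 2) • (1 : Mat N) - μ else 0

/-- The Virasoro operator `z∂_z + 1/2` of the `A_1`-singularity (here `μ = 1/2 - m_1/h = 0`), by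
its matrix elements on scalar series. -/
def virasoroA1 : ℤ → ℤ → ℂ := fun m n => if m = n then (n : ℂ) + 1 / 2 else 0

/-- The operator `P^{(i)}`: an operator `P` on scalar series, acting on the `i`-th component of
`ℂᴺ`-valued series (and by zero on the other components). -/
def onComponent (i : Fin N) (P : ℤ → ℤ → ℂ) : FormalOp N := fun m n => Matrix.single i i (P m n)

/-- An invertible operator together with its inverse. -/
structure Factor (N : ℕ) where
  op : FormalOp N
  inv : FormalOp N

/-- The conjugation `g⁻¹ ∘ P ∘ g`. -/
def Factor.conj (g : Factor N) (P : FormalOp N) : FormalOp N := comp (comp g.inv P) g.op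

/-- Both compositions in `g⁻¹ ∘ P ∘ g` are defined. -/
def Factor.ConjDefined (g : Factor N) (P : FormalOp N) : Prop :=
  Composable g.inv P ∧ Composable (comp g.inv P) g.op

/-- `M⁻¹ P M` for a formal product `M = g₁ g₂ ⋯ g_r`, that is
`g_r⁻¹ (⋯ (g₂⁻¹ (g₁⁻¹ P g₁) g₂) ⋯) g_r`. -/
def conjugate : List (Factor N) → FormalOp N → FormalOp N
  | [], P => P
  | g :: M, P => conjugate M (g.conj P)

/-- All the compositions in `M⁻¹ P M` are defined. -/
def ConjugateDefined : List (Factor N) → FormalOp N → Prop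
  | [], _ => True
  | g :: M, P => g.ConjDefined P ∧ ConjugateDefined M (g.conj P)

/-- The series `∑_k A^k w^k / k!` in an indeterminate `w`. -/
def expSeries (A : Mat N) : PowerSeries (Mat N) :=
  PowerSeries.mk fun k => (1 / (k.factorial : ℂ)) • A ^ k

end FormalOp

/-! ## The matrices `Ψ`, `U` and the series `S`, `R` -/

/-- A neighbourhood in the locus of semisimple points, with the (nondegenerate) critical points
`x^{(i)}(τ)` of `f_τ` numbered, branches of the square roots of the Hessians
`Δ_i(τ) = Hess f_τ(x^{(i)}(τ))` chosen, and the critical values `uⁱ(τ) = f_τ(x^{(i)}(τ))` forming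
a local coordinate system. -/
structure SemisimpleChart (D : HomogeneousBasis T) where
  domain : Set (Param T)
  isOpen_domain : IsOpen domain
  crit : Param T → Fin T.rank → Fin 3 → ℂ
  differentiableOn_crit : ∀ i, DifferentiableOn ℂ (fun τ => crit τ i) domain
  isCriticalPoint : ∀ τ ∈ domain, ∀ i, IsCriticalPoint (D.deformation τ) (crit τ i)
  injective_crit : ∀ τ ∈ domain, Function.Injective (crit τ)
  hessian_ne_zero : ∀ τ ∈ domain, ∀ i, hessian (D.deformation τ) (crit τ i) ≠ 0
  sqrtHessian : Param T → Fin T.rank → ℂ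
  differentiableOn_sqrtHessian : ∀ i, DifferentiableOn ℂ (fun τ => sqrtHessian τ i) domain
  sq_sqrtHessian : ∀ τ ∈ domain, ∀ i,
    sqrtHessian τ i ^ 2 = hessian (D.deformation τ) (crit τ i)
  isUnit_det_critValue : ∀ τ ∈ domain, IsUnit (Matrix.det (Matrix.of fun i a =>
    fderiv ℂ (fun σ => eval (crit σ i) (D.deformation σ)) τ (Pi.single a 1)))

/-- The derivative at `τ`, along `v`, of a matrix-valued function. -/
def matDeriv {N : ℕ} (Y : (Fin N → ℂ) → Mat N) (τ v : Fin N → ℂ) : Mat N :=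
  Matrix.of fun i j => fderiv ℂ (fun σ => Y σ i j) τ v

namespace SemisimpleChart

variable {D : HomogeneousBasis T} (W : SemisimpleChart D)

/-- The canonical coordinates: the critical values `uⁱ(τ)`. -/
def canonical (τ : Param T) (i : Fin T.rank) : ℂ := eval (W.crit τ i) (D.deformation τ)

/-- The matrix `∂uⁱ/∂τᵃ`. The columns of its inverse are the vectors `∂/∂uⁱ`, in components with
respect to `∂/∂τᵃ`. -/
def canonicalJacobian (τ : Param T) : Mat T.rank :=
  Matrix.of fun i a => fderiv ℂ (fun σ => W.canonical σ i) τ (Pi.single a 1)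

/-- `U = diag(u¹, …, uᴺ)`. -/
def U (τ : Param T) : Mat T.rank := Matrix.diagonal (W.canonical τ)

/-- `Ψ(q¹, …, qᴺ) = ∑ qⁱ √Δ_i ∂/∂uⁱ`, a map from `ℂᴺ` to the tangent space at `τ`, which is
identified with `H` by means of the flat coordinates. -/
def Psi (F : FlatCoordinates D) (τ : Param T) : Mat T.rank :=
  polyJacobian F.t τ * (W.canonicalJacobian τ)⁻¹ * Matrix.diagonal (W.sqrtHessian τ)

end SemisimpleChart

/-- `S = 1 + S_1 z⁻¹ + S_2 z⁻² + ⋯` is the gauge transformation between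
`∇_0 = ∂_z - μ/z` and `∇_τ = ∂_z - μ/z + (E•)/z²`, that is `S ∇_0 S⁻¹ = ∇_τ`, with
`S(-z)^* S(z) = 1`, where `*` is the adjoint with respect to the residue pairing on `H`. -/
structure IsCalibration {D : HomogeneousBasis T} (F : FlatCoordinates D) (τ : Param T)
    (S : (PowerSeries (Mat T.rank))ˣ) : Prop where
  coeff_zero : PowerSeries.coeff 0 S.val = 1
  gauge : ∃ B : Mat T.rank, F.IsMulMatrix τ (D.euler τ) B ∧
    FormalOp.comp (FormalOp.mulNeg S.val) (FormalOp.connection D.mu 0) =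
      FormalOp.comp (FormalOp.connection D.mu B) (FormalOp.mulNeg S.val)
  symplectic : ∀ k : ℕ, ∑ p ∈ Finset.HasAntidiagonal.antidiagonal k, (-1 : ℂ) ^ p.1 •
      ((PowerSeries.coeff p.1 S.val).transpose * D.gram 0 * PowerSeries.coeff p.2 S.val) =
    if k = 0 then D.gram 0 else 0

/-- `R = 1 + R_1 z + R_2 z² + ⋯`, with coefficients holomorphic in `τ`, is such that
`J = Ψ R e^{U/z}` satisfies `z ∂_v J = v • J` for every tangent vector `v`, that
`(z∂_z + L_E) R = 0`, and that `R(-z)^t R(z) = 1`. The differential equation is written, after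
cancellation of `e^{U/z}`, as `z ∂_v(ΨR) + ΨR ∂_v U = v • ΨR`, coefficient by coefficient. -/
structure IsAsymptoticSolution {D : HomogeneousBasis T} (F : FlatCoordinates D)
    (W : SemisimpleChart D) (R : Param T → (PowerSeries (Mat T.rank))ˣ) : Prop where
  differentiableOn : ∀ k i j,
    DifferentiableOn ℂ (fun τ => PowerSeries.coeff k (R τ).val i j) W.domain
  coeff_zero : ∀ τ ∈ W.domain, PowerSeries.coeff 0 (R τ).val = 1
  equation : ∀ τ ∈ W.domain, ∀ v : Param T, ∃ B : Mat T.rank, F.IsMulMatrix τ v B ∧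
    W.Psi F τ * PowerSeries.coeff 0 (R τ).val * matDeriv W.U τ v =
      B * (W.Psi F τ * PowerSeries.coeff 0 (R τ).val) ∧
    ∀ k : ℕ,
      matDeriv (fun σ => W.Psi F σ * PowerSeries.coeff k (R σ).val) τ v +
          W.Psi F τ * PowerSeries.coeff (k + 1) (R τ).val * matDeriv W.U τ v =
        B * (W.Psi F τ * PowerSeries.coeff (k + 1) (R τ).val)
  homogeneous : ∀ τ ∈ W.domain, ∀ k : ℕ,
    (k : ℂ) • PowerSeries.coeff k (R τ).val +
      matDeriv (fun σ => PowerSeries.coeff k (R σ).val) τ (D.euler τ) = 0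
  symplectic : ∀ τ ∈ W.domain, ∀ k : ℕ, ∑ p ∈ Finset.HasAntidiagonal.antidiagonal k, (-1 : ℂ) ^ p.1 •
      ((PowerSeries.coeff p.1 (R τ).val).transpose * PowerSeries.coeff p.2 (R τ).val) =
    if k = 0 then 1 else 0

/-- The formal product `M = S⁻¹ Ψ R e^{U/z}` at the point `τ`; `S` and `e^{U/z}` are series in
`z⁻¹`, and `R` is a series in `z`. -/
def transformation {D : HomogeneousBasis T} (F : FlatCoordinates D) (W : SemisimpleChart D)
    (S : (PowerSeries (Mat T.rank))ˣ) (R : Param T → (PowerSeries (Mat T.rank))ˣ)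
    (τ : Param T) : List (FormalOp.Factor T.rank) :=
  [⟨FormalOp.mulNeg S⁻¹.val, FormalOp.mulNeg S.val⟩,
   ⟨FormalOp.const (W.Psi F τ), FormalOp.const (W.Psi F τ)⁻¹⟩,
   ⟨FormalOp.mulPos (R τ).val, FormalOp.mulPos (R τ)⁻¹.val⟩,
   ⟨FormalOp.mulNeg (FormalOp.expSeries (W.U τ)), FormalOp.mulNeg (FormalOp.expSeries (-W.U τ))⟩]

end SimpleSingularity

end

open SimpleSingularity

/-! Since l₀ = z∇₀ + 1/2, the gauge property of S turns it into z∂_z + 1/2 - μ + (E•)/z. The columns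
of Ψ are eigenvectors of E• with eigenvalues uⁱ, so Ψ turns this into z∂_z + 1/2 - V + U/z with V =
Ψ⁻¹μΨ. Along E the differential equation for ΨR becomes algebraic, because L_E Ψ = μΨ and L_E R =
-z∂_z R; the resulting recursion (`IsAsymptoticSolution.recursion`) says that R intertwines this
operator with z∂_z + 1/2 + U/z. Finally e^{U/z} removes U/z, and z∂_z + 1/2 acts componentwise.

The geometric input is L_E Ψ = μΨ (`matDeriv_Psi_euler`). Euler's identity and the nondegeneracy of
the Hessian make the critical points quasi-homogeneous in τ. Hence ∂uⁱ/∂τᵃ = ψ_a(x^{(i)}) has weight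
deg ψ_a, and √Δ_i has weight 3/2 minus the sum of the weights of the variables, which is 1/2 - 1/h.
Homogeneity of the flat coordinates supplies the rest.

As for finiteness, S, Ψ and e^{U/z} never raise the power of z and R never lowers it. Compositions
are finite and associative inside each class. Each intermediate result is a band operator
`shiftedVirasoro`, which belongs to both classes, so one can pass from one class to the other
between conjugations. -/

noncomputable section
namespace SimpleSingularity

/-! ### Composition of one-sided bounded operators -/

namespace FormalOp

variable {N : ℕ}

/-- The operator raises the power of `z` by at most `c`. -/
def RaisesAtMost (c : ℤ) (K : FormalOp N) : Prop := ∀ m n, K m n ≠ 0 → m ≤ n + c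

/-- The operator lowers the power of `z` by at most `c`. -/
def LowersAtMost (c : ℤ) (K : FormalOp N) : Prop := ∀ m n, K m n ≠ 0 → n ≤ m + c

theorem composable_of_raisesAtMost {c d : ℤ} {K L : FormalOp N} (hK : RaisesAtMost c K)
    (hL : RaisesAtMost d L) : Composable K L := fun m n =>
  (Set.finite_Icc (m - c) (n + d)).subset fun k hk => by
    have h1 := hK _ _ hk.1
    have h2 := hL _ _ hk.2
    constructor <;> omega

theorem composable_of_lowersAtMost {c d : ℤ} {K L : FormalOp N} (hK : LowersAtMost c K)
    (hL : LowersAtMost d L) : Composable K L := fun m n =>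
  (Set.finite_Icc (n - d) (m + c)).subset fun k hk => by
    have h1 := hK _ _ hk.1
    have h2 := hL _ _ hk.2
    constructor <;> omega

theorem comp_eq_sum (K L : FormalOp N) (m n : ℤ) (s : Finset ℤ)
    (h : ∀ k, K m k ≠ 0 → L k n ≠ 0 → k ∈ s) : comp K L m n = ∑ k ∈ s, K m k * L k n :=
  finsum_eq_sum_of_support_subset _ fun k hk =>
    h k (left_ne_zero_of_mul hk) (right_ne_zero_of_mul hk)

theorem RaisesAtMost.comp {c d : ℤ} {K L : FormalOp N} (hK : RaisesAtMost c K)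
    (hL : RaisesAtMost d L) : RaisesAtMost (c + d) (comp K L) := fun m n h => by
  obtain ⟨k, hk⟩ := not_forall.1 (mt finsum_eq_zero_of_forall_eq_zero h)
  have h1 := hK _ _ (left_ne_zero_of_mul hk)
  have h2 := hL _ _ (right_ne_zero_of_mul hk)
  omega

theorem LowersAtMost.comp {c d : ℤ} {K L : FormalOp N} (hK : LowersAtMost c K)
    (hL : LowersAtMost d L) : LowersAtMost (c + d) (comp K L) := fun m n h => by
  obtain ⟨k, hk⟩ := not_forall.1 (mt finsum_eq_zero_of_forall_eq_zero h)
  have h1 := hK _ _ (left_ne_zero_of_mul hk)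
  have h2 := hL _ _ (right_ne_zero_of_mul hk)
  omega

/-- For fixed outer indices the bounds confine both intermediate indices to finite intervals, so the
two bracketings are the two orders of summation of one finite double sum. -/
theorem comp_assoc_of_raisesAtMost {c d e : ℤ} {K L M : FormalOp N} (hK : RaisesAtMost c K)
    (hL : RaisesAtMost d L) (hM : RaisesAtMost e M) :
    FormalOp.comp (FormalOp.comp K L) M = FormalOp.comp K (FormalOp.comp L M) := by
  funext m n
  have hKL := hK.comp hL
  have hLM := hL.comp hM
  rw [comp_eq_sum (FormalOp.comp K L) M m n (Finset.Icc (m - (c + d)) (n + e))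
      fun k h1 h2 => Finset.mem_Icc.2
        ⟨by have := hKL _ _ h1; omega, by have := hM _ _ h2; omega⟩,
    comp_eq_sum K (FormalOp.comp L M) m n (Finset.Icc (m - c) (n + (d + e)))
      fun k h1 h2 => Finset.mem_Icc.2
        ⟨by have := hK _ _ h1; omega, by have := hLM _ _ h2; omega⟩]
  have e1 : ∀ l ∈ Finset.Icc (m - (c + d)) (n + e), FormalOp.comp K L m l * M l n =
      ∑ k ∈ Finset.Icc (m - c) (n + (d + e)), K m k * L k l * M l n := fun l hl => by
    rw [comp_eq_sum K L m l (Finset.Icc (m - c) (n + (d + e))) fun k h1 h2 => Finset.mem_Icc.2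
      ⟨by have := hK _ _ h1; omega, by
        have := hL _ _ h2; have := (Finset.mem_Icc.1 hl).2; omega⟩, Finset.sum_mul]
  have e2 : ∀ k ∈ Finset.Icc (m - c) (n + (d + e)), K m k * FormalOp.comp L M k n =
      ∑ l ∈ Finset.Icc (m - (c + d)) (n + e), K m k * L k l * M l n := fun k hk => by
    rw [comp_eq_sum L M k n (Finset.Icc (m - (c + d)) (n + e)) fun l h1 h2 => Finset.mem_Icc.2
      ⟨by have := hL _ _ h1; have := (Finset.mem_Icc.1 hk).1; omega, by
        have := hM _ _ h2; omega⟩, Finset.mul_sum]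
    simp only [mul_assoc]
  rw [Finset.sum_congr rfl e1, Finset.sum_congr rfl e2, Finset.sum_comm]

/-- The operator conjugated by the substitution `z ↦ z⁻¹`. -/
def reflect (K : FormalOp N) : FormalOp N := fun m n => K (-m) (-n)

theorem reflect_reflect (K : FormalOp N) : reflect (reflect K) = K := by
  funext m n
  simp [reflect]

theorem comp_reflect (K L : FormalOp N) :
    comp (reflect K) (reflect L) = reflect (comp K L) := by
  funext m n
  exact finsum_comp_equiv (Equiv.neg ℤ) (f := fun k => K (-m) k * L k (-n))

theorem LowersAtMost.reflect {c : ℤ} {K : FormalOp N} (hK : LowersAtMost c K) :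
    RaisesAtMost c (reflect K) := fun m n h => by
  have := hK _ _ h
  omega

theorem comp_assoc_of_lowersAtMost {c d e : ℤ} {K L M : FormalOp N} (hK : LowersAtMost c K)
    (hL : LowersAtMost d L) (hM : LowersAtMost e M) :
    FormalOp.comp (FormalOp.comp K L) M = FormalOp.comp K (FormalOp.comp L M) := by
  have h := comp_assoc_of_raisesAtMost hK.reflect hL.reflect hM.reflect
  rw [comp_reflect, comp_reflect, comp_reflect, comp_reflect] at h
  rw [← reflect_reflect (FormalOp.comp (FormalOp.comp K L) M), h, reflect_reflect]

/-! ### Multiplication operators -/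

theorem raisesAtMost_mulNeg (G : PowerSeries (Mat N)) : RaisesAtMost 0 (mulNeg G) :=
  fun m n h => by
    by_contra hlt
    exact h (if_neg (by omega))

theorem lowersAtMost_mulPos (G : PowerSeries (Mat N)) : LowersAtMost 0 (mulPos G) :=
  fun m n h => by
    by_contra hlt
    exact h (if_neg (by omega))

theorem raisesAtMost_const (A : Mat N) : RaisesAtMost 0 (const A) := fun m n h => by
  by_contra hlt
  exact h (if_neg (by omega))

theorem mulNeg_apply_add (G : PowerSeries (Mat N)) (m : ℤ) (k : ℕ) :
    mulNeg G m (m + k) = PowerSeries.coeff k G := by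
  rw [mulNeg, if_pos (by omega)]
  congr 2
  omega

theorem mulNeg_apply_of_lt (G : PowerSeries (Mat N)) {m n : ℤ} (h : n < m) : mulNeg G m n = 0 :=
  if_neg (by omega)

theorem reflect_mulNeg (G : PowerSeries (Mat N)) : reflect (mulNeg G) = mulPos G := by
  funext m n
  simp only [reflect, mulNeg, mulPos, neg_le_neg_iff]
  congr 3
  omega

theorem comp_mulNeg (G H : PowerSeries (Mat N)) :
    comp (mulNeg G) (mulNeg H) = mulNeg (G * H) := by
  funext m n
  by_cases hmn : m ≤ n
  · obtain ⟨j, rfl⟩ := Int.le.dest hmn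
    rw [mulNeg_apply_add, PowerSeries.coeff_mul, Finset.Nat.sum_antidiagonal_eq_sum_range_succ_mk,
      comp_eq_sum (s := (Finset.range (j + 1)).image fun i : ℕ => m + (i : ℤ)),
      Finset.sum_image fun a _ b _ h => by simpa using h]
    · refine Finset.sum_congr rfl fun i hi => ?_
      have hij : i ≤ j := by simpa [Nat.lt_succ_iff] using hi
      rw [mulNeg_apply_add]
      congr 1
      rw [← mulNeg_apply_add H (m + i) (j - i)]
      congr 1
      omega
    · intro k h1 h2
      have h1 := raisesAtMost_mulNeg G _ _ h1
      have h2 := raisesAtMost_mulNeg H _ _ h2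
      simp only [Finset.mem_image, Finset.mem_range]
      exact ⟨(k - m).toNat, by omega, by omega⟩
  · rw [mulNeg_apply_of_lt _ (by omega), comp_eq_sum (s := ∅), Finset.sum_empty]
    intro k h1 h2
    have h1 := raisesAtMost_mulNeg G _ _ h1
    have h2 := raisesAtMost_mulNeg H _ _ h2
    omega

theorem comp_mulPos (G H : PowerSeries (Mat N)) :
    comp (mulPos G) (mulPos H) = mulPos (G * H) := by
  rw [← reflect_mulNeg, ← reflect_mulNeg, ← reflect_mulNeg, comp_reflect, comp_mulNeg]

theorem mulNeg_one : mulNeg (1 : PowerSeries (Mat N)) = const 1 := by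
  funext m n
  simp only [mulNeg, const, PowerSeries.coeff_one]
  split_ifs <;> first | rfl | omega

theorem mulPos_one : mulPos (1 : PowerSeries (Mat N)) = const 1 := by
  rw [← reflect_mulNeg, mulNeg_one]
  funext m n
  simp [reflect, const]

theorem comp_const_left (A : Mat N) (K : FormalOp N) :
    comp (const A) K = fun m n => A * K m n := by
  funext m n
  rw [comp_eq_sum (s := {m})]
  · simp [const]
  · intro k h _
    by_contra hk
    exact h (if_neg fun h => hk (by simp [h]))

theorem comp_const_right (A : Mat N) (K : FormalOp N) :
    comp K (const A) = fun m n => K m n * A := by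
  funext m n
  rw [comp_eq_sum (s := {n})]
  · simp [const]
  · intro k _ h
    by_contra hk
    exact h (if_neg fun h => hk (by simp [h]))

/-! ### Virasoro operators with a 1/z term -/

/-- The operator `z∂_z + 1/2 - V + B/z`. -/
def shiftedVirasoro (V B : Mat N) : FormalOp N :=
  fun m n => if m = n then ((n : ℂ) + 1 / 2) • (1 : Mat N) - V else if m = n - 1 then B else 0

theorem shiftedVirasoro_self (V B : Mat N) (n : ℤ) :
    shiftedVirasoro V B n n = ((n : ℂ) + 1 / 2) • (1 : Mat N) - V := if_pos rfl

theorem shiftedVirasoro_succ (V B : Mat N) (n : ℤ) : shiftedVirasoro V B n (n + 1) = B := by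
  rw [shiftedVirasoro, if_neg (by omega), if_pos (by omega)]

theorem shiftedVirasoro_pred (V B : Mat N) (n : ℤ) : shiftedVirasoro V B (n - 1) n = B := by
  rw [shiftedVirasoro, if_neg (by omega), if_pos (by omega)]

theorem shiftedVirasoro_ne_zero {V B : Mat N} {m n : ℤ} (h : shiftedVirasoro V B m n ≠ 0) :
    m = n ∨ m = n - 1 := by
  by_contra! hc
  exact h (by rw [shiftedVirasoro, if_neg hc.1, if_neg hc.2])

theorem shiftedVirasoro_zero_right (V : Mat N) : shiftedVirasoro V 0 = virasoro V := by
  funext m n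
  simp [shiftedVirasoro, virasoro]

theorem raisesAtMost_shiftedVirasoro (V B : Mat N) : RaisesAtMost 0 (shiftedVirasoro V B) :=
  fun m n h => by rcases shiftedVirasoro_ne_zero h with h | h <;> omega

theorem lowersAtMost_shiftedVirasoro (V B : Mat N) : LowersAtMost 1 (shiftedVirasoro V B) :=
  fun m n h => by rcases shiftedVirasoro_ne_zero h with h | h <;> omega

theorem comp_shiftedVirasoro_left (V B : Mat N) (K : FormalOp N) (m n : ℤ) :
    comp (shiftedVirasoro V B) K m n =
      (((m : ℂ) + 1 / 2) • (1 : Mat N) - V) * K m n + B * K (m + 1) n := by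
  rw [comp_eq_sum (s := {m, m + 1}), Finset.sum_pair (by omega), shiftedVirasoro_self,
    shiftedVirasoro_succ]
  intro k h _
  rcases shiftedVirasoro_ne_zero h with h | h <;> simp [h]

theorem comp_shiftedVirasoro_right (V B : Mat N) (K : FormalOp N) (m n : ℤ) :
    comp K (shiftedVirasoro V B) m n =
      K m n * (((n : ℂ) + 1 / 2) • (1 : Mat N) - V) + K m (n - 1) * B := by
  rw [comp_eq_sum (s := {n, n - 1}), Finset.sum_pair (by omega), shiftedVirasoro_self,
    shiftedVirasoro_pred]
  intro k _ h
  rcases shiftedVirasoro_ne_zero h with h | h <;> simp [h]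

/-- Reduces a conjugation to the intertwining relation P g = g Q. The bound on Q is needed to
reassociate g⁻¹(gQ). -/
theorem Factor.conj_of_raisesAtMost {g : Factor N} {P Q : FormalOp N}
    (h1 : RaisesAtMost 0 g.op) (h2 : RaisesAtMost 0 g.inv) (hP : RaisesAtMost 0 P)
    (hQ : RaisesAtMost 0 Q) (hg : comp g.inv g.op = const 1)
    (h : comp P g.op = comp g.op Q) : g.ConjDefined P ∧ g.conj P = Q := by
  refine ⟨⟨composable_of_raisesAtMost h2 hP, composable_of_raisesAtMost (h2.comp hP) h1⟩, ?_⟩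
  rw [Factor.conj, comp_assoc_of_raisesAtMost h2 hP h1, h, ← comp_assoc_of_raisesAtMost h2 h1 hQ,
    hg, comp_const_left]
  simp

/-- The mirror version, needed for R. The constant c leaves room for the term U/z, which lowers the
power of z by one. -/
theorem Factor.conj_of_lowersAtMost {c : ℤ} {g : Factor N} {P Q : FormalOp N}
    (h1 : LowersAtMost 0 g.op) (h2 : LowersAtMost 0 g.inv) (hP : LowersAtMost c P)
    (hQ : LowersAtMost c Q) (hg : comp g.inv g.op = const 1)
    (h : comp P g.op = comp g.op Q) : g.ConjDefined P ∧ g.conj P = Q := by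
  refine ⟨⟨composable_of_lowersAtMost h2 hP, composable_of_lowersAtMost (h2.comp hP) h1⟩, ?_⟩
  rw [Factor.conj, comp_assoc_of_lowersAtMost h2 hP h1, h, ← comp_assoc_of_lowersAtMost h2 h1 hQ,
    hg, comp_const_left]
  simp

theorem connection_ne_zero {V B : Mat N} {m n : ℤ} (h : connection V B m n ≠ 0) :
    m = n - 1 ∨ m = n - 2 := by
  by_contra! hc
  exact h (by rw [connection, if_neg hc.1, if_neg hc.2])

/-- Both Virasoro operators are z times a connection plus 1/2, and S commutes with z and with
scalars. -/
theorem virasoro_gauge {V B : Mat N} {S : PowerSeries (Mat N)}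
    (h : comp (mulNeg S) (connection V 0) = comp (connection V B) (mulNeg S)) :
    comp (mulNeg S) (virasoro V) = comp (shiftedVirasoro V B) (mulNeg S) := by
  rw [← shiftedVirasoro_zero_right]
  funext m n
  -- Multiplication by z carries row m - 1 of the connection to row m of the Virasoro operator.
  have e := congr_fun (congr_fun h (m - 1)) n
  rw [comp_eq_sum (s := {n - 1}), Finset.sum_singleton,
    comp_eq_sum (connection V B) (s := {m, m + 1}), Finset.sum_pair (by omega)] at e
  · rw [comp_shiftedVirasoro_left, comp_shiftedVirasoro_right]
    have s1 : mulNeg S (m - 1) (n - 1) = mulNeg S m n := by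
      simp only [mulNeg, sub_le_sub_iff_right, sub_sub_sub_cancel_right]
    rw [s1, connection, if_pos rfl, connection, if_pos rfl, connection, if_neg (by omega),
      if_pos (by omega)] at e
    rw [mul_zero, add_zero, add_smul, add_sub_right_comm, mul_add, e, add_smul,
      add_sub_right_comm _ _ V, add_mul]
    simp only [smul_mul_assoc, mul_smul_comm, one_mul, mul_one]
    abel
  · intro k h _
    rcases connection_ne_zero h with h | h
    · exact Finset.mem_insert.2 (Or.inl (by omega))
    · exact Finset.mem_insert.2 (Or.inr (Finset.mem_singleton.2 (by omega)))
  · intro k _ h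
    rcases connection_ne_zero h with hk | hk
    · simp [hk]
    · exact absurd (by rw [connection, if_neg (by omega), if_pos hk]) h

theorem conj_calibration {V B : Mat N} {S : (PowerSeries (Mat N))ˣ}
    (h : comp (mulNeg S.val) (connection V 0) = comp (connection V B) (mulNeg S.val)) :
    (⟨mulNeg S⁻¹.val, mulNeg S.val⟩ : Factor N).ConjDefined (virasoro V) ∧
      (⟨mulNeg S⁻¹.val, mulNeg S.val⟩ : Factor N).conj (virasoro V) = shiftedVirasoro V B := by
  have hV : RaisesAtMost 0 (virasoro V) :=
    shiftedVirasoro_zero_right V ▸ raisesAtMost_shiftedVirasoro V 0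
  refine Factor.conj_of_raisesAtMost (raisesAtMost_mulNeg _) (raisesAtMost_mulNeg _) hV
    (raisesAtMost_shiftedVirasoro V B) (by rw [comp_mulNeg, S.mul_inv, mulNeg_one]) ?_
  have key : ∀ K : FormalOp N, comp (const 1) K = K := fun K => by simp [comp_const_left]
  have key' : ∀ K : FormalOp N, comp K (const 1) = K := fun K => by simp [comp_const_right]
  dsimp only
  -- The gauge relation has S on the other side, so S⁻¹S is inserted on the left: l₀S⁻¹ = S⁻¹(S
  -- l₀)S⁻¹.
  rw [← key (comp (virasoro V) _), ← mulNeg_one, ← S.inv_mul, ← comp_mulNeg,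
    comp_assoc_of_raisesAtMost (raisesAtMost_mulNeg _) (raisesAtMost_mulNeg _)
      (hV.comp (raisesAtMost_mulNeg _)),
    ← comp_assoc_of_raisesAtMost (raisesAtMost_mulNeg _) hV (raisesAtMost_mulNeg _),
    virasoro_gauge h,
    comp_assoc_of_raisesAtMost (raisesAtMost_shiftedVirasoro V B) (raisesAtMost_mulNeg _)
      (raisesAtMost_mulNeg _), comp_mulNeg, S.mul_inv, mulNeg_one, key']

theorem conj_const {V B V' B' Y : Mat N} (hY : IsUnit Y.det) (hV : V * Y = Y * V')
    (hB : B * Y = Y * B') :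
    (⟨const Y, const Y⁻¹⟩ : Factor N).ConjDefined (shiftedVirasoro V B) ∧
      (⟨const Y, const Y⁻¹⟩ : Factor N).conj (shiftedVirasoro V B) = shiftedVirasoro V' B' := by
  refine Factor.conj_of_raisesAtMost (raisesAtMost_const _) (raisesAtMost_const _)
    (raisesAtMost_shiftedVirasoro V B) (raisesAtMost_shiftedVirasoro V' B') ?_ ?_
  · rw [comp_const_left]
    funext m n
    simp only [const]
    split_ifs
    · exact Matrix.nonsing_inv_mul Y hY
    · simp
  · rw [comp_const_left, comp_const_right]
    funext m n
    simp only [shiftedVirasoro]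
    split_ifs
    · rw [sub_mul, mul_sub, hV]; simp
    · exact hB
    · simp

/-- The hypotheses are the coefficients of z⁻¹ and of z^k, k ≥ 0, in the intertwining relation (z∂_z
- V + U/z)R = R(z∂_z + U/z). -/
theorem conj_mulPos {V U : Mat N} {R : (PowerSeries (Mat N))ˣ}
    (h0 : PowerSeries.coeff 0 R.val * U = U * PowerSeries.coeff 0 R.val)
    (h : ∀ k : ℕ, (k : ℂ) • PowerSeries.coeff k R.val + U * PowerSeries.coeff (k + 1) R.val =
      V * PowerSeries.coeff k R.val + PowerSeries.coeff (k + 1) R.val * U) :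
    (⟨mulPos R.val, mulPos R⁻¹.val⟩ : Factor N).ConjDefined (shiftedVirasoro V U) ∧
      (⟨mulPos R.val, mulPos R⁻¹.val⟩ : Factor N).conj (shiftedVirasoro V U) =
        shiftedVirasoro 0 U := by
  refine Factor.conj_of_lowersAtMost (lowersAtMost_mulPos _) (lowersAtMost_mulPos _)
    (lowersAtMost_shiftedVirasoro V U) (lowersAtMost_shiftedVirasoro 0 U)
    (by rw [comp_mulPos, R.inv_mul, mulPos_one]) ?_
  funext m n
  rw [comp_shiftedVirasoro_left, comp_shiftedVirasoro_right]
  have hneg : ∀ m n : ℤ, m < n → mulPos R.val m n = 0 := fun m n h => if_neg (by omega)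
  have hpos : ∀ (m n : ℤ) (k : ℕ), m = n + k → mulPos R.val m n = PowerSeries.coeff k R.val :=
    fun m n k h => by
      rw [mulPos, if_pos (by omega)]
      congr 2
      omega
  dsimp only
  -- Only the difference m - n matters: below -1 everything vanishes, at -1 the relation is `h0`,
  -- and at k ≥ 0 it is `h k`.
  rcases lt_trichotomy m (n - 1) with hmn | hmn | hmn
  · simp [hneg m n (by omega), hneg (m + 1) n (by omega), hneg m (n - 1) (by omega)]
  · rw [hneg m n (by omega), hpos (m + 1) n 0 (by omega), hpos m (n - 1) 0 (by omega), h0]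
    simp
  · obtain ⟨k, rfl⟩ : ∃ k : ℕ, m = n + k := ⟨(m - n).toNat, by omega⟩
    rw [hpos (n + k) n k rfl, hpos (n + k + 1) n (k + 1) (by push_cast; omega),
      hpos (n + k) (n - 1) (k + 1) (by push_cast; omega)]
    have e := h k
    simp only [sub_zero, sub_mul, smul_mul_assoc, mul_smul_comm, one_mul, mul_one]
    push_cast
    have e' : U * PowerSeries.coeff (k + 1) R.val = V * PowerSeries.coeff k R.val +
        PowerSeries.coeff (k + 1) R.val * U - (k : ℂ) • PowerSeries.coeff k R.val := by
      rw [← e]; abel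
    rw [e', add_smul, add_smul, add_smul]
    abel

theorem expSeries_neg_mul (A : Mat N) : expSeries (-A) * expSeries A = 1 := by
  ext1 n
  rw [PowerSeries.coeff_mul, PowerSeries.coeff_one]
  -- By the binomial theorem the n-th coefficient of the product is (-A + A)^n / n!.
  have hc : Commute (-A) A := (Commute.refl A).neg_left
  have e := hc.add_pow' n
  rw [neg_add_cancel] at e
  have key : ∑ p ∈ Finset.HasAntidiagonal.antidiagonal n, PowerSeries.coeff p.1 (expSeries (-A)) *
      PowerSeries.coeff p.2 (expSeries A) = (1 / (n.factorial : ℂ)) • (0 : Mat N) ^ n := by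
    rw [e, Finset.smul_sum]
    refine Finset.sum_congr rfl fun p hp => ?_
    have hp' : p.1 + p.2 = n := by simpa using hp
    simp only [expSeries, PowerSeries.coeff_mk, smul_mul_smul_comm]
    rw [← Nat.cast_smul_eq_nsmul ℂ, smul_smul]
    congr 1
    have h1 : (p.1.factorial : ℂ) ≠ 0 := by exact_mod_cast p.1.factorial_ne_zero
    have h2 : (p.2.factorial : ℂ) ≠ 0 := by exact_mod_cast p.2.factorial_ne_zero
    have h3 : (n.factorial : ℂ) ≠ 0 := by exact_mod_cast n.factorial_ne_zero
    have h4 : (n.choose p.1 : ℂ) * p.1.factorial * p.2.factorial = n.factorial := by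
      rw [← hp', Nat.choose_symm_add]
      exact_mod_cast Nat.add_choose_mul_factorial_mul_factorial p.1 p.2
    field_simp
    linear_combination -h4
  rw [key]
  rcases eq_or_ne n 0 with rfl | hn
  · simp
  · simp [hn]

/-- Because z∂_z e^{U/z} = -(U/z)e^{U/z}, the exponential cancels the 1/z term. On coefficients this
is U^k/k! = (k+1)U^(k+1)/(k+1)! after one more factor U on the left. -/
theorem conj_expSeries (U : Mat N) :
    (⟨mulNeg (expSeries U), mulNeg (expSeries (-U))⟩ : Factor N).ConjDefined
        (shiftedVirasoro 0 U) ∧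
      (⟨mulNeg (expSeries U), mulNeg (expSeries (-U))⟩ : Factor N).conj (shiftedVirasoro 0 U) =
        virasoro 0 := by
  rw [← shiftedVirasoro_zero_right]
  refine Factor.conj_of_raisesAtMost (raisesAtMost_mulNeg _) (raisesAtMost_mulNeg _)
    (raisesAtMost_shiftedVirasoro 0 U) (raisesAtMost_shiftedVirasoro 0 0)
    (by rw [comp_mulNeg, expSeries_neg_mul, mulNeg_one]) ?_
  funext m n
  rw [comp_shiftedVirasoro_left, comp_shiftedVirasoro_right]
  dsimp only
  rcases lt_trichotomy m n with hmn | rfl | hmn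
  · obtain ⟨k, rfl⟩ : ∃ k : ℕ, n = m + 1 + k := ⟨(n - m - 1).toNat, by omega⟩
    rw [mulNeg_apply_add (expSeries U) (m + 1) k, add_assoc m, add_comm (1 : ℤ),
      show (k : ℤ) + 1 = ((k + 1 : ℕ) : ℤ) by push_cast; rfl, mulNeg_apply_add]
    simp only [sub_zero, mul_zero, add_zero, smul_mul_assoc, mul_smul_comm, one_mul, mul_one,
      expSeries, PowerSeries.coeff_mk, ← pow_succ', smul_smul, ← add_smul]
    congr 1
    have h1 : (k.factorial : ℂ) ≠ 0 := by exact_mod_cast k.factorial_ne_zero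
    have h2 : ((k : ℂ) + 1) ≠ 0 := by exact_mod_cast k.succ_ne_zero
    rw [Nat.factorial_succ]
    push_cast
    field_simp
    ring
  · rw [mulNeg_apply_of_lt _ (by omega : m < m + 1)]
    simp
  · simp [mulNeg_apply_of_lt _ hmn, mulNeg_apply_of_lt _ (by omega : n < m + 1)]

theorem sum_onComponent_virasoroA1 :
    ∑ i : Fin N, onComponent i virasoroA1 = virasoro (0 : Mat N) := by
  funext m n
  rw [Finset.sum_apply, Finset.sum_apply]
  simp only [onComponent, virasoroA1, virasoro, sub_zero]
  split_ifs
  · ext a b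
    rcases eq_or_ne a b with rfl | hab
    · simp [Matrix.sum_apply, Matrix.single_apply]
    · rw [Matrix.sum_apply, Finset.sum_eq_zero]
      · simp [hab]
      · intro i _
        rw [Matrix.single_apply, if_neg]
        rintro ⟨rfl, rfl⟩
        exact hab rfl
  · simp

end FormalOp

open MvPolynomial

/-! ## Euler's identity and derivatives of evaluations -/

section Euler

variable {σ : Type*} [Fintype σ]

/-- Euler's identity for rational weights. -/
theorem sum_weight_mul_eval_pderiv {w : σ → ℚ} {d : ℚ} {p : MvPolynomial σ ℂ}
    (h : IsWeightedHomogeneous w p d) (x : σ → ℂ) :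
    ∑ i, eval x (pderiv i p) * ((w i : ℂ) * x i) = (d : ℂ) * eval x p := by
  conv_rhs => rw [p.as_sum]
  -- Monomials are eigenvectors of x_i ∂_i, with the exponent of x_i as eigenvalue.
  have e : ∀ i, eval x (pderiv i p) * ((w i : ℂ) * x i) =
      ∑ m ∈ p.support, (w i : ℂ) * (m i : ℂ) * eval x (monomial m (coeff m p)) := fun i => by
    conv_lhs => rw [p.as_sum]
    rw [map_sum, map_sum, Finset.sum_mul]
    refine Finset.sum_congr rfl fun m _ => ?_
    have h1 := congr_arg (eval x) (X_mul_pderiv_monomial (i := i) (m := m) (r := coeff m p))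
    rw [map_mul, eval_X, map_nsmul, nsmul_eq_mul] at h1
    linear_combination (w i : ℂ) * h1
  rw [Finset.sum_congr rfl fun i _ => e i, Finset.sum_comm, map_sum, Finset.mul_sum]
  refine Finset.sum_congr rfl fun m hm => ?_
  rw [← Finset.sum_mul]
  congr 1
  have hw := h (mem_support_iff.1 hm)
  rw [Finsupp.weight_apply, Finsupp.sum_fintype (h := by simp)] at hw
  rw [← hw]
  push_cast
  exact Finset.sum_congr rfl fun i _ => by rw [nsmul_eq_mul]; push_cast; ring

variable {V : Type*} [NormedAddCommGroup V] [NormedSpace ℂ V]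

theorem hasFDerivAt_eval {x : V → σ → ℂ} {x' : σ → V →L[ℂ] ℂ} {τ : V}
    (hx : ∀ i, HasFDerivAt (fun y => x y i) (x' i) τ) (p : MvPolynomial σ ℂ) :
    HasFDerivAt (fun y => eval (x y) p) (∑ i, eval (x τ) (pderiv i p) • x' i) τ := by
  classical
  induction p using MvPolynomial.induction_on with
  | C a =>
    simp only [eval_C, pderiv_C]
    refine (hasFDerivAt_const (𝕜 := ℂ) a τ).congr_fderiv ?_
    ext v
    simp [sum_apply]
  | add p q hp hq =>
    simp only [map_add]
    refine (hp.fun_add hq).congr_fderiv ?_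
    ext v
    simp only [add_apply, sum_apply, smul_apply, smul_eq_mul, add_mul, Finset.sum_add_distrib]
  | mul_X p j hp =>
    simp only [map_mul, eval_X]
    refine (hp.fun_mul (hx j)).congr_fderiv ?_
    ext v
    simp only [Derivation.leibniz, map_add, smul_eq_mul, map_mul, eval_X, pderiv_X, add_apply,
      sum_apply, smul_apply, add_mul, Finset.sum_add_distrib, Finset.mul_sum]
    congr 1
    · rw [Finset.sum_eq_single j]
      · simp
      · intro i _ hi
        simp [hi.symm]
      · simp
    · exact Finset.sum_congr rfl fun i _ => by ring

end Euler

/-! ## Functions that are homogeneous along a vector field -/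

section Weight

variable {V : Type*} [NormedAddCommGroup V] [NormedSpace ℂ V]

/-- `f` is differentiable at `τ` with derivative `c f(τ)` in the direction `v`. -/
def HasWeightAt (τ v : V) (c : ℂ) (f : V → ℂ) : Prop :=
  DifferentiableAt ℂ f τ ∧ fderiv ℂ f τ v = c * f τ

variable {τ v : V} {c d e : ℂ} {f g : V → ℂ}

theorem HasWeightAt.add (hf : HasWeightAt τ v c f) (hg : HasWeightAt τ v c g) :
    HasWeightAt τ v c fun y => f y + g y := by
  refine ⟨hf.1.add hg.1, ?_⟩
  rw [fderiv_fun_add hf.1 hg.1, add_apply, hf.2, hg.2]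
  ring

theorem HasWeightAt.sub (hf : HasWeightAt τ v c f) (hg : HasWeightAt τ v c g) :
    HasWeightAt τ v c fun y => f y - g y := by
  refine ⟨hf.1.sub hg.1, ?_⟩
  rw [fderiv_fun_sub hf.1 hg.1, sub_apply, hf.2, hg.2]
  ring

theorem HasWeightAt.mul (hf : HasWeightAt τ v c f) (hg : HasWeightAt τ v d g)
    (he : c + d = e) : HasWeightAt τ v e fun y => f y * g y := by
  refine ⟨hf.1.mul hg.1, ?_⟩
  rw [fderiv_fun_mul hf.1 hg.1]
  simp only [add_apply, smul_apply, smul_eq_mul, hf.2, hg.2, ← he]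
  ring

theorem HasWeightAt.congr (hf : HasWeightAt τ v c f) (h : g =ᶠ[nhds τ] f) :
    HasWeightAt τ v c g :=
  ⟨hf.1.congr_of_eventuallyEq h, by rw [h.fderiv_eq, hf.2, h.eq_of_nhds]⟩

/-- Differentiating g² gives 2g times the derivative of g, and 2g(τ) can be cancelled. This passes
from Δ_i to √Δ_i. -/
theorem HasWeightAt.of_sq (hf : HasWeightAt τ v c fun y => g y ^ 2) (hg : DifferentiableAt ℂ g τ)
    (h0 : g τ ≠ 0) (hd : 2 * d = c) : HasWeightAt τ v d g := by
  refine ⟨hg, ?_⟩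
  have h := hf.2
  rw [fderiv_fun_pow 2 hg] at h
  simp only [smul_apply, smul_eq_mul, ← hd, nsmul_eq_mul] at h
  have h2 : (2 * g τ) * (fderiv ℂ g τ v) = (2 * g τ) * (d * g τ) := by
    norm_num at h
    linear_combination h
  exact mul_left_cancel₀ (mul_ne_zero two_ne_zero h0) h2

end Weight

/-! ## Derivatives of matrix-valued functions -/

section MatDeriv

variable {N : ℕ} {τ v : Fin N → ℂ} {Y Z : (Fin N → ℂ) → Mat N}

/-- All matrix entries of `Y` are differentiable at `τ`. -/
def MatDifferentiableAt (Y : (Fin N → ℂ) → Mat N) (τ : Fin N → ℂ) : Prop :=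
  ∀ i j, DifferentiableAt ℂ (fun σ => Y σ i j) τ

theorem MatDifferentiableAt.mul (hY : MatDifferentiableAt Y τ) (hZ : MatDifferentiableAt Z τ) :
    MatDifferentiableAt (fun σ => Y σ * Z σ) τ := fun i j => by
  simp only [Matrix.mul_apply]
  exact DifferentiableAt.fun_sum fun k _ => (hY i k).fun_mul (hZ k j)

theorem matDeriv_mul (hY : MatDifferentiableAt Y τ) (hZ : MatDifferentiableAt Z τ) :
    matDeriv (fun σ => Y σ * Z σ) τ v = matDeriv Y τ v * Z τ + Y τ * matDeriv Z τ v := by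
  ext i j
  simp only [matDeriv, Matrix.of_apply, Matrix.add_apply, Matrix.mul_apply]
  rw [fderiv_fun_sum fun k _ => (hY i k).fun_mul (hZ k j), sum_apply,
    ← Finset.sum_add_distrib]
  refine Finset.sum_congr rfl fun k _ => ?_
  rw [fderiv_fun_mul (hY i k) (hZ k j)]
  simp only [add_apply, smul_apply, smul_eq_mul]
  ring

theorem MatDifferentiableAt.det (hY : MatDifferentiableAt Y τ) :
    DifferentiableAt ℂ (fun σ => (Y σ).det) τ := by
  simp only [Matrix.det_apply, Units.smul_def, zsmul_eq_mul]
  exact DifferentiableAt.fun_sum fun p _ =>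
    (HasFDerivAt.finsetProd fun i _ => (hY (p i) i).hasFDerivAt).differentiableAt.const_mul _

theorem MatDifferentiableAt.inv (hY : MatDifferentiableAt Y τ) (h : IsUnit (Y τ).det) :
    MatDifferentiableAt (fun σ => (Y σ)⁻¹) τ := fun i j => by
  simp only [Matrix.inv_def, Ring.inverse_eq_inv', Matrix.smul_apply, smul_eq_mul,
    Matrix.adjugate_apply]
  refine (hY.det.inv h.ne_zero).mul (MatDifferentiableAt.det fun k l => ?_)
  by_cases hk : k = j
  · subst hk
    simp
  · simpa [Matrix.updateRow_ne hk] using hY k l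

theorem matDeriv_congr (h : Y =ᶠ[nhds τ] Z) : matDeriv Y τ v = matDeriv Z τ v := by
  ext i j
  exact congr_arg (fun L : (Fin N → ℂ) →L[ℂ] ℂ => L v)
    (h.fun_comp fun A : Mat N => A i j).fderiv_eq

/-- Differentiate YY⁻¹ = 1, an identity that must hold near τ and not only at τ. -/
theorem matDeriv_inv {G : Mat N} (hY : MatDifferentiableAt Y τ) (h : ∀ᶠ σ in nhds τ, IsUnit (Y σ).det)
    (hG : matDeriv Y τ v = Y τ * G) :
    matDeriv (fun σ => (Y σ)⁻¹) τ v = -(G * (Y τ)⁻¹) := by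
  have hu := h.self_of_nhds
  have e : matDeriv (fun σ => Y σ * (Y σ)⁻¹) τ v = 0 := by
    rw [matDeriv_congr (Z := fun _ => 1) (h.mono fun σ hσ => Matrix.mul_nonsing_inv _ hσ)]
    ext i j
    simp [matDeriv]
  rw [matDeriv_mul hY (hY.inv hu), hG, mul_assoc, ← mul_add] at e
  have e' := congr_arg (fun A => (Y τ)⁻¹ * A) e
  simp only [← mul_assoc, Matrix.nonsing_inv_mul _ hu, one_mul, mul_zero] at e'
  exact eq_neg_of_add_eq_zero_right e'

end MatDeriv

/-! ## Homogeneity of the singularities -/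

theorem ADE.coxeter_ne_zero (T : ADE) : T.coxeter ≠ 0 := by
  cases T with
  | A N hN => simp only [ADE.coxeter]; positivity
  | D N hN =>
    have : (4 : ℚ) ≤ N := by exact_mod_cast hN
    simp only [ADE.coxeter]
    intro h
    linarith
  | E6 => norm_num [ADE.coxeter]
  | E7 => norm_num [ADE.coxeter]
  | E8 => norm_num [ADE.coxeter]

/-- This relation between weights and Coxeter number makes the weight of √Δ_i agree with the scalar
part of μ. -/
theorem ADE.sum_weight (T : ADE) : ∑ i, T.weight i = 1 + 1 / T.coxeter := by
  rw [Fin.sum_univ_three]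
  cases T with
  | A N hN => simp [ADE.weight, ADE.coxeter]; ring
  | D N hN =>
    have h4 : (4 : ℚ) ≤ N := by exact_mod_cast hN
    have : (N : ℚ) - 1 ≠ 0 := by linarith
    simp [ADE.weight, ADE.coxeter]
    field_simp
    ring
  | E6 => norm_num [ADE.weight, ADE.coxeter, Matrix.cons_val_two]
  | E7 => norm_num [ADE.weight, ADE.coxeter, Matrix.cons_val_two]
  | E8 => norm_num [ADE.weight, ADE.coxeter, Matrix.cons_val_two]

theorem isWeightedHomogeneous_X_pow (w : Fin 3 → ℚ) (i : Fin 3) (n : ℕ) {d : ℚ}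
    (h : n * w i = d) : IsWeightedHomogeneous w (X i ^ n : MvPolynomial (Fin 3) ℂ) d := by
  rw [← h, ← nsmul_eq_mul]
  exact (isWeightedHomogeneous_X ℂ w i).pow n

theorem isWeightedHomogeneous_C_mul {w : Fin 3 → ℚ} {d : ℚ} (a : ℂ)
    {p : MvPolynomial (Fin 3) ℂ} (h : IsWeightedHomogeneous w p d) :
    IsWeightedHomogeneous w (C a * p) d := by
  simpa using (isWeightedHomogeneous_C w a).mul h

theorem isWeightedHomogeneous_sub {w : Fin 3 → ℚ} {d : ℚ}
    {p q : MvPolynomial (Fin 3) ℂ} (h : IsWeightedHomogeneous w p d)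
    (h' : IsWeightedHomogeneous w q d) : IsWeightedHomogeneous w (p - q) d :=
  (weightedHomogeneousSubmodule ℂ w d).sub_mem h h'

theorem ADE.isWeightedHomogeneous_f (T : ADE) : IsWeightedHomogeneous T.weight T.f 1 := by
  cases T with
  | A N hN =>
    refine ((isWeightedHomogeneous_C_mul _ (isWeightedHomogeneous_X_pow _ _ _ ?_)).add
      (isWeightedHomogeneous_C_mul _ (isWeightedHomogeneous_X_pow _ _ _ ?_))).add
      (isWeightedHomogeneous_C_mul _ (isWeightedHomogeneous_X_pow _ _ _ ?_))
    · have : (N : ℚ) + 1 ≠ 0 := by positivity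
      simp [ADE.weight]
      field_simp
    · norm_num [ADE.weight, Matrix.cons_val_two]
    · norm_num [ADE.weight, Matrix.cons_val_two]
  | D N hN =>
    have h4 : (4 : ℚ) ≤ N := by exact_mod_cast hN
    have h1 : (N : ℚ) - 1 ≠ 0 := by linarith
    refine (isWeightedHomogeneous_sub (d := 1) ?_ (isWeightedHomogeneous_X_pow _ _ _ ?_)).add
      (isWeightedHomogeneous_X_pow _ _ _ ?_)
    · convert! (isWeightedHomogeneous_X_pow _ 0 2 rfl).mul (isWeightedHomogeneous_X ℂ _ 1) using 1
      simp [ADE.weight]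
      field_simp
      ring
    · simp [ADE.weight, Nat.cast_sub (by omega : 1 ≤ N), h1]
    · norm_num [ADE.weight, Matrix.cons_val_two]
  | E6 =>
    refine ((isWeightedHomogeneous_X_pow _ _ _ ?_).add (isWeightedHomogeneous_X_pow _ _ _ ?_)).add
      (isWeightedHomogeneous_X_pow _ _ _ ?_) <;> norm_num [ADE.weight, Matrix.cons_val_two]
  | E7 =>
    refine ((isWeightedHomogeneous_X_pow _ _ _ ?_).add ?_).add
      (isWeightedHomogeneous_X_pow _ _ _ ?_)
    · norm_num [ADE.weight, Matrix.cons_val_two]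
    · convert! (isWeightedHomogeneous_X ℂ _ 0).mul (isWeightedHomogeneous_X_pow _ 1 3 rfl) using 1
      norm_num [ADE.weight, Matrix.cons_val_two]
    · norm_num [ADE.weight, Matrix.cons_val_two]
  | E8 =>
    refine ((isWeightedHomogeneous_X_pow _ _ _ ?_).add (isWeightedHomogeneous_X_pow _ _ _ ?_)).add
      (isWeightedHomogeneous_X_pow _ _ _ ?_) <;> norm_num [ADE.weight, Matrix.cons_val_two]

variable {T : ADE}

theorem HomogeneousBasis.paramDeg_eq (D : HomogeneousBasis T) (a : Fin T.rank) :
    D.paramDeg a = 1 - D.deg a := by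
  have := T.coxeter_ne_zero
  simp only [HomogeneousBasis.paramDeg, HomogeneousBasis.exponent]
  field_simp
  ring

/-! ### Linear families of polynomials -/

/-- A family of polynomials `g + ∑ τᵃ φ_a`. -/
def linearFamily {N : ℕ} (g : MvPolynomial (Fin 3) ℂ) (φ : Fin N → MvPolynomial (Fin 3) ℂ)
    (τ : Fin N → ℂ) : MvPolynomial (Fin 3) ℂ := g + ∑ a, C (τ a) * φ a

section LinearFamily

variable {N : ℕ} (g : MvPolynomial (Fin 3) ℂ) (φ : Fin N → MvPolynomial (Fin 3) ℂ)
  (τ : Fin N → ℂ)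

/-- Closure under ∂_j lets one chain rule and one Euler identity serve f_τ, its gradient and its
Hessian. -/
theorem pderiv_linearFamily (j : Fin 3) :
    pderiv j (linearFamily g φ τ) = linearFamily (pderiv j g) (fun a => pderiv j (φ a)) τ := by
  simp [linearFamily, Derivation.leibniz]

theorem eval_linearFamily (x : Fin 3 → ℂ) :
    eval x (linearFamily g φ τ) = eval x g + ∑ a, τ a * eval x (φ a) := by
  simp [linearFamily]

variable {τ}

theorem hasFDerivAt_eval_linearFamily {x : (Fin N → ℂ) → Fin 3 → ℂ}
    {x' : Fin 3 → (Fin N → ℂ) →L[ℂ] ℂ} (hx : ∀ i, HasFDerivAt (fun y => x y i) (x' i) τ) :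
    HasFDerivAt (fun σ => eval (x σ) (linearFamily g φ σ))
      (∑ j, eval (x τ) (pderiv j (linearFamily g φ τ)) • x' j +
        ∑ a, eval (x τ) (φ a) • ContinuousLinearMap.proj (R := ℂ) (φ := fun _ : Fin N => ℂ) a)
      τ := by
  simp only [eval_linearFamily]
  have hproj : ∀ a, HasFDerivAt (fun σ : Fin N → ℂ => σ a)
      (ContinuousLinearMap.proj (R := ℂ) (φ := fun _ : Fin N => ℂ) a) τ := fun a =>
    (ContinuousLinearMap.proj (R := ℂ) (φ := fun _ : Fin N => ℂ) a).hasFDerivAt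
  have h := (hasFDerivAt_eval hx g).fun_add
    (HasFDerivAt.fun_sum fun a (_ : a ∈ Finset.univ) => (hproj a).fun_mul (hasFDerivAt_eval hx (φ a)))
  refine h.congr_fderiv ?_
  ext v
  simp only [pderiv_linearFamily, eval_linearFamily, add_apply, sum_apply, smul_apply, smul_eq_mul,
    add_mul, Finset.sum_add_distrib, Finset.mul_sum, Finset.sum_mul, ← add_assoc]
  rw [Finset.sum_comm]
  simp only [mul_assoc]

/-- Euler's identity for a quasi-homogeneous family. -/
theorem euler_linearFamily {w : Fin 3 → ℚ} {d : ℚ} {e : Fin N → ℚ}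
    (hg : IsWeightedHomogeneous w g d) (hφ : ∀ a, IsWeightedHomogeneous w (φ a) (d - e a))
    (x : Fin 3 → ℂ) :
    ∑ j, eval x (pderiv j (linearFamily g φ τ)) * ((w j : ℂ) * x j) +
      ∑ a, eval x (φ a) * ((e a : ℂ) * τ a) = (d : ℂ) * eval x (linearFamily g φ τ) := by
  have h1 := sum_weight_mul_eval_pderiv hg x
  have h2 := fun a => sum_weight_mul_eval_pderiv (hφ a) x
  simp only [pderiv_linearFamily, eval_linearFamily, add_mul, mul_add, Finset.sum_add_distrib, h1,
    Finset.sum_mul, Finset.mul_sum]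
  rw [Finset.sum_comm, add_assoc, ← Finset.sum_add_distrib]
  congr 1
  refine Finset.sum_congr rfl fun a _ => ?_
  simp only [mul_assoc]
  rw [← Finset.mul_sum, h2 a]
  push_cast
  ring

end LinearFamily

theorem HomogeneousBasis.deformation_eq (D : HomogeneousBasis T) (τ : Param T) :
    D.deformation τ = linearFamily T.f D.ψ τ := rfl

/-! ## Homogeneity at a semisimple point -/

namespace SemisimpleChart

variable {D : HomogeneousBasis T} (W : SemisimpleChart D) {τ : Param T}

theorem differentiableAt_crit (hτ : τ ∈ W.domain) (i : Fin T.rank) (j : Fin 3) :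
    DifferentiableAt ℂ (fun σ => W.crit σ i j) τ :=
  differentiableAt_pi.1
    ((W.differentiableOn_crit i).differentiableAt (W.isOpen_domain.mem_nhds hτ)) j

theorem hasFDerivAt_eval_crit (hτ : τ ∈ W.domain) (i : Fin T.rank) (g : MvPolynomial (Fin 3) ℂ)
    (φ : Fin T.rank → MvPolynomial (Fin 3) ℂ) :
    HasFDerivAt (fun σ => eval (W.crit σ i) (linearFamily g φ σ))
      (∑ j, eval (W.crit τ i) (pderiv j (linearFamily g φ τ)) •
          fderiv ℂ (fun σ => W.crit σ i j) τ +
        ∑ a, eval (W.crit τ i) (φ a) •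
          ContinuousLinearMap.proj (R := ℂ) (φ := fun _ : Fin T.rank => ℂ) a) τ :=
  hasFDerivAt_eval_linearFamily g φ fun j => (W.differentiableAt_crit hτ i j).hasFDerivAt

/-- The critical points are quasi-homogeneous functions of the parameters. -/
theorem fderiv_crit_euler (hτ : τ ∈ W.domain) (i : Fin T.rank) (j : Fin 3) :
    fderiv ℂ (fun σ => W.crit σ i j) τ (D.euler τ) = (T.weight j : ℂ) * W.crit τ i j := by
  set x := W.crit τ i
  -- The defect y of homogeneity is shown to lie in the kernel of the invertible Hessian.
  set y : Fin 3 → ℂ := fun k =>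
    fderiv ℂ (fun σ => W.crit σ i k) τ (D.euler τ) - (T.weight k : ℂ) * x k with hy
  set A : Matrix (Fin 3) (Fin 3) ℂ :=
    Matrix.of fun k l => eval x (pderiv k (pderiv l (D.deformation τ))) with hA
  have hdet : IsUnit A.transpose.det := by
    rw [Matrix.det_transpose]
    exact isUnit_iff_ne_zero.2 (W.hessian_ne_zero τ hτ i)
  have hAy : A.transpose.mulVec y = 0 := by
    funext l
    -- The derivative along E of the critical equation ∂_l f_τ = 0 is compared with Euler's identity
    -- for ∂_l f_τ, whose right-hand side vanishes at the critical point; the explicit τ-terms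
    -- cancel.
    have h1 := (W.hasFDerivAt_eval_crit hτ i (pderiv l T.f) fun a => pderiv l (D.ψ a)).fderiv
    have h0 : (fun σ => eval (W.crit σ i)
        (linearFamily (pderiv l T.f) (fun a => pderiv l (D.ψ a)) σ)) =ᶠ[nhds τ] fun _ => 0 := by
      filter_upwards [W.isOpen_domain.mem_nhds hτ] with σ hσ
      rw [← pderiv_linearFamily]
      exact W.isCriticalPoint σ hσ i l
    have h2 := euler_linearFamily (τ := τ) (e := D.paramDeg) (pderiv l T.f)
      (fun a => pderiv l (D.ψ a)) (T.isWeightedHomogeneous_f.pderiv (sub_add_cancel _ _))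
      (fun a => (D.homogeneous a).pderiv (by rw [D.paramDeg_eq]; ring)) x
    rw [h0.fderiv_eq] at h1
    have h1 := congr_arg (fun L => L (D.euler τ)) h1
    rw [← pderiv_linearFamily] at h1 h2
    have h3 : eval x (pderiv l (linearFamily T.f D.ψ τ)) = 0 := W.isCriticalPoint τ hτ i l
    rw [h3, mul_zero] at h2
    simp only [fderiv_fun_const, Pi.zero_apply, zero_apply, add_apply,
      sum_apply, smul_apply, smul_eq_mul,
      ContinuousLinearMap.proj_apply, HomogeneousBasis.euler] at h1
    simp only [Matrix.mulVec, dotProduct, hA, hy, Matrix.transpose_apply, Matrix.of_apply,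
      Pi.zero_apply, mul_sub, Finset.sum_sub_distrib, D.deformation_eq]
    linear_combination -h1 - h2
  have h := congr_fun (Matrix.eq_zero_of_mulVec_eq_zero hdet.ne_zero hAy) j
  exact sub_eq_zero.1 h

/-- A quasi-homogeneous family of polynomials gives a quasi-homogeneous function by evaluation
at a critical point. -/
theorem hasWeightAt_eval_crit (hτ : τ ∈ W.domain) (i : Fin T.rank) {g : MvPolynomial (Fin 3) ℂ}
    {φ : Fin T.rank → MvPolynomial (Fin 3) ℂ} {d : ℚ} (hg : IsWeightedHomogeneous T.weight g d)
    (hφ : ∀ a, IsWeightedHomogeneous T.weight (φ a) (d - D.paramDeg a)) :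
    HasWeightAt τ (D.euler τ) d fun σ => eval (W.crit σ i) (linearFamily g φ σ) := by
  have h := W.hasFDerivAt_eval_crit hτ i g φ
  refine ⟨h.differentiableAt, ?_⟩
  rw [h.fderiv, ← euler_linearFamily g φ hg hφ]
  simp only [add_apply, sum_apply,
    smul_apply, smul_eq_mul, ContinuousLinearMap.proj_apply,
    HomogeneousBasis.euler, W.fderiv_crit_euler hτ]

theorem hasWeightAt_canonical (hτ : τ ∈ W.domain) (i : Fin T.rank) :
    HasWeightAt τ (D.euler τ) 1 fun σ => W.canonical σ i := by
  have h := W.hasWeightAt_eval_crit hτ i (d := 1) T.isWeightedHomogeneous_f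
    (φ := D.ψ) fun a => by rw [D.paramDeg_eq, sub_sub_cancel]; exact D.homogeneous a
  rwa [Rat.cast_one] at h

/-- `∂uⁱ/∂τᵃ = ψ_a(x^{(i)})`. -/
theorem canonicalJacobian_apply (hτ : τ ∈ W.domain) (i a : Fin T.rank) :
    W.canonicalJacobian τ i a = eval (W.crit τ i) (D.ψ a) := by
  have h := (W.hasFDerivAt_eval_crit hτ i T.f D.ψ).fderiv
  have h3 : ∀ l, eval (W.crit τ i) (pderiv l (linearFamily T.f D.ψ τ)) = 0 :=
    W.isCriticalPoint τ hτ i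
  simp only [canonicalJacobian, Matrix.of_apply, canonical, D.deformation_eq]
  rw [h]
  simp [h3, Pi.single_apply]

theorem isUnit_det_canonicalJacobian (hτ : τ ∈ W.domain) :
    IsUnit (W.canonicalJacobian τ).det := W.isUnit_det_critValue τ hτ

theorem hasWeightAt_canonicalJacobian (hτ : τ ∈ W.domain) (i a : Fin T.rank) :
    HasWeightAt τ (D.euler τ) (D.deg a) fun σ => W.canonicalJacobian σ i a := by
  have h := W.hasWeightAt_eval_crit hτ i (φ := 0) (D.homogeneous a)
    fun _ => isWeightedHomogeneous_zero ℂ _ _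
  refine h.congr ?_
  filter_upwards [W.isOpen_domain.mem_nhds hτ] with σ hσ
  rw [W.canonicalJacobian_apply hσ]
  simp [linearFamily]

/-- The entry ∂_j∂_k f_τ has weight 1 - w_j - w_k, so all six products in the determinant have the
same weight. -/
theorem hasWeightAt_hessian (hτ : τ ∈ W.domain) (i : Fin T.rank) :
    HasWeightAt τ (D.euler τ) (3 - 2 * ∑ j, (T.weight j : ℂ))
      fun σ => hessian (D.deformation σ) (W.crit σ i) := by
  have h : ∀ j k, HasWeightAt τ (D.euler τ) (1 - T.weight k - T.weight j : ℚ)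
      fun σ => eval (W.crit σ i) (pderiv j (pderiv k (D.deformation σ))) := fun j k => by
    simp only [D.deformation_eq, pderiv_linearFamily]
    refine W.hasWeightAt_eval_crit hτ i
      ((T.isWeightedHomogeneous_f.pderiv (sub_add_cancel _ _)).pderiv (sub_add_cancel _ _))
      fun a => ?_
    exact ((D.homogeneous a).pderiv (sub_add_cancel _ _)).pderiv
      (by rw [D.paramDeg_eq]; ring)
  simp only [hessian, Matrix.det_fin_three, Matrix.of_apply, Fin.sum_univ_three]
  refine HasWeightAt.sub (HasWeightAt.add (HasWeightAt.add (HasWeightAt.sub (HasWeightAt.sub ?_ ?_)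
    ?_) ?_) ?_) ?_ <;>
  · refine ((h _ _).mul (h _ _) rfl).mul (h _ _) ?_
    push_cast
    ring

theorem sqrtHessian_ne_zero (hτ : τ ∈ W.domain) (i : Fin T.rank) : W.sqrtHessian τ i ≠ 0 := by
  intro h
  have := W.hessian_ne_zero τ hτ i
  rw [← W.sq_sqrtHessian τ hτ i, h] at this
  simp at this

theorem hasWeightAt_sqrtHessian (hτ : τ ∈ W.domain) (i : Fin T.rank) :
    HasWeightAt τ (D.euler τ) (1 / 2 - 1 / T.coxeter : ℚ) fun σ => W.sqrtHessian σ i := by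
  have h : HasWeightAt τ (D.euler τ) (3 - 2 * ∑ j, (T.weight j : ℂ))
      fun σ => W.sqrtHessian σ i ^ 2 := by
    refine (W.hasWeightAt_hessian hτ i).congr ?_
    filter_upwards [W.isOpen_domain.mem_nhds hτ] with σ hσ
    exact W.sq_sqrtHessian σ hσ i
  refine h.of_sq ((W.differentiableOn_sqrtHessian i).differentiableAt
    (W.isOpen_domain.mem_nhds hτ)) (W.sqrtHessian_ne_zero hτ i) ?_
  have hw : ∑ j, (T.weight j : ℂ) = 1 + 1 / (T.coxeter : ℂ) := by exact_mod_cast T.sum_weight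
  rw [hw]
  push_cast
  ring

theorem isUnit_det_Psi (F : FlatCoordinates D) (hτ : τ ∈ W.domain) :
    IsUnit (W.Psi F τ).det := by
  rw [Psi, Matrix.det_mul, Matrix.det_mul, Matrix.det_diagonal]
  refine ((F.isUnit_det τ).mul ?_).mul
    (isUnit_iff_ne_zero.2 (Finset.prod_ne_zero_iff.2 fun i _ => W.sqrtHessian_ne_zero hτ i))
  rw [Matrix.isUnit_nonsing_inv_det_iff]
  exact W.isUnit_det_canonicalJacobian hτ

theorem matDeriv_U_euler (hτ : τ ∈ W.domain) : matDeriv W.U τ (D.euler τ) = W.U τ := by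
  ext i j
  simp only [matDeriv, U, Matrix.of_apply]
  rcases eq_or_ne i j with rfl | h
  · simpa using (W.hasWeightAt_canonical hτ i).2
  · simp [Matrix.diagonal_apply_ne _ h]

/-- At a semisimple point the multiplication matrix is determined by the tangent vector. -/
theorem isMulMatrix_unique (F : FlatCoordinates D) (hτ : τ ∈ W.domain) {v : Param T}
    {B B' : Mat T.rank} (h : F.IsMulMatrix τ v B) (h' : F.IsMulMatrix τ v B') : B = B' := by
  -- Evaluation at the critical points factors through the quotient algebra, and on tangent vectors
  -- it is the invertible matrix ∂uⁱ/∂τᵃ; so the values of a product determine the tangent vector.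
  have hvanish : ∀ i, ∀ p ∈ jacobianIdeal (D.deformation τ), eval (W.crit τ i) p = 0 := by
    intro i p hp
    have hle : jacobianIdeal (D.deformation τ) ≤ RingHom.ker (eval (W.crit τ i)) := by
      rw [jacobianIdeal, Ideal.span_le]
      rintro _ ⟨j, rfl⟩
      exact W.isCriticalPoint τ hτ i j
    exact hle hp
  have heval : ∀ i (y : Param T), eval (W.crit τ i) (D.tangentPoly y) =
      (W.canonicalJacobian τ).mulVec y i := fun i y => by
    simp only [HomogeneousBasis.tangentPoly, map_sum, map_mul, eval_C, Matrix.mulVec, dotProduct,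
      W.canonicalJacobian_apply hτ]
    exact Finset.sum_congr rfl fun a _ => mul_comm _ _
  have hJ : IsUnit (polyJacobian F.t τ) := (Matrix.isUnit_iff_isUnit_det _).2 (F.isUnit_det τ)
  have hC : IsUnit (W.canonicalJacobian τ) :=
    (Matrix.isUnit_iff_isUnit_det _).2 (W.isUnit_det_canonicalJacobian hτ)
  refine Matrix.mulVec_injective (funext fun y => ?_)
  refine Matrix.mulVec_injective_of_isUnit ((Matrix.isUnit_nonsing_inv_iff).2 hJ)
    (Matrix.mulVec_injective_of_isUnit hC (funext fun i => ?_))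
  have e := hvanish i _ (h y)
  have e' := hvanish i _ (h' y)
  rw [map_sub, heval i (F.toTangent τ _)] at e e'
  exact (sub_eq_zero.1 e).symm.trans (sub_eq_zero.1 e')

/-! ### Homogeneity of Ψ -/

theorem differentiable_polyJacobian {N : ℕ} (t : Fin N → MvPolynomial (Fin N) ℂ) (τ : Fin N → ℂ) :
    MatDifferentiableAt (polyJacobian t) τ := fun a b =>
  (hasFDerivAt_eval (x := fun σ : Fin N → ℂ => σ)
    (fun i => (ContinuousLinearMap.proj (R := ℂ) (φ := fun _ : Fin N => ℂ) i).hasFDerivAt)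
    (pderiv b (t a))).differentiableAt

theorem matDeriv_polyJacobian_euler (F : FlatCoordinates D) (τ : Param T) :
    matDeriv (polyJacobian F.t) τ (D.euler τ) =
      Matrix.diagonal (fun a => (D.paramDeg a : ℂ)) * polyJacobian F.t τ -
        polyJacobian F.t τ * Matrix.diagonal fun a => (D.paramDeg a : ℂ) := by
  ext a b
  have h := hasFDerivAt_eval (x := fun σ : Param T => σ) (τ := τ)
    (fun i => (ContinuousLinearMap.proj (R := ℂ) (φ := fun _ : Fin T.rank => ℂ) i).hasFDerivAt)
    (pderiv b (F.t a))
  have e := sum_weight_mul_eval_pderiv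
    ((F.homogeneous a).pderiv (i := b) (sub_add_cancel _ _)) τ
  simp only [matDeriv, polyJacobian, Matrix.of_apply, Matrix.sub_apply, Matrix.diagonal_mul,
    Matrix.mul_diagonal]
  rw [h.fderiv]
  simp only [sum_apply, smul_apply, smul_eq_mul,
    ContinuousLinearMap.proj_apply, HomogeneousBasis.euler]
  rw [e]
  push_cast
  ring

theorem matDifferentiableAt_canonicalJacobian (hτ : τ ∈ W.domain) :
    MatDifferentiableAt W.canonicalJacobian τ :=
  fun i a => (W.hasWeightAt_canonicalJacobian hτ i a).1

theorem matDifferentiableAt_diagonal_sqrtHessian (hτ : τ ∈ W.domain) :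
    MatDifferentiableAt (fun σ => Matrix.diagonal (W.sqrtHessian σ)) τ := fun i j => by
  rcases eq_or_ne i j with rfl | h
  · simpa using (W.hasWeightAt_sqrtHessian hτ i).1
  · simp [Matrix.diagonal_apply_ne _ h]

theorem matDifferentiableAt_Psi (F : FlatCoordinates D) (hτ : τ ∈ W.domain) :
    MatDifferentiableAt (W.Psi F) τ :=
  ((differentiable_polyJacobian F.t τ).mul ((W.matDifferentiableAt_canonicalJacobian hτ).inv
    (W.isUnit_det_canonicalJacobian hτ))).mul (W.matDifferentiableAt_diagonal_sqrtHessian hτ)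

/-- `Ψ` is homogeneous: `L_E Ψ = μ Ψ`. -/
theorem matDeriv_Psi_euler (F : FlatCoordinates D) (hτ : τ ∈ W.domain) :
    matDeriv (W.Psi F) τ (D.euler τ) = D.mu * W.Psi F τ := by
  have hC : matDeriv W.canonicalJacobian τ (D.euler τ) =
      W.canonicalJacobian τ * Matrix.diagonal fun a => (D.deg a : ℂ) := by
    ext i a
    rw [Matrix.mul_diagonal, mul_comm]
    exact (W.hasWeightAt_canonicalJacobian hτ i a).2
  have hS : matDeriv (fun σ => Matrix.diagonal (W.sqrtHessian σ)) τ (D.euler τ) =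
      ((1 / 2 - 1 / T.coxeter : ℚ) : ℂ) • Matrix.diagonal (W.sqrtHessian τ) := by
    ext i j
    simp only [matDeriv, Matrix.of_apply, Matrix.smul_apply]
    rcases eq_or_ne i j with rfl | h
    · simpa using (W.hasWeightAt_sqrtHessian hτ i).2
    · simp [Matrix.diagonal_apply_ne _ h]
  have hCinv := matDeriv_inv (W.matDifferentiableAt_canonicalJacobian hτ)
    (by
      filter_upwards [W.isOpen_domain.mem_nhds hτ] with σ hσ
      exact W.isUnit_det_canonicalJacobian hσ) hC
  have hCd := (W.matDifferentiableAt_canonicalJacobian hτ).inv (W.isUnit_det_canonicalJacobian hτ)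
  have hJd := differentiable_polyJacobian F.t τ
  have hdeg : (Matrix.diagonal fun a => (D.paramDeg a : ℂ)) =
      1 - Matrix.diagonal fun a => (D.deg a : ℂ) := by
    rw [← Matrix.diagonal_one, Matrix.diagonal_sub]
    congr 1
    funext a
    rw [D.paramDeg_eq]
    push_cast
    rfl
  have hmu : D.mu = ((1 / 2 - 1 / T.coxeter : ℚ) : ℂ) • 1 -
      Matrix.diagonal fun a => (D.deg a : ℂ) := by
    rw [← Matrix.diagonal_one, ← Matrix.diagonal_smul, Matrix.diagonal_sub, HomogeneousBasis.mu]
    congr 1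
    funext a
    have := T.coxeter_ne_zero
    have e : 1 / 2 - D.exponent a / T.coxeter = 1 / 2 - 1 / T.coxeter - D.deg a := by
      rw [HomogeneousBasis.exponent]
      field_simp
      ring
    rw [e]
    simp
  change matDeriv (fun σ => polyJacobian F.t σ * (W.canonicalJacobian σ)⁻¹ *
    Matrix.diagonal (W.sqrtHessian σ)) τ (D.euler τ) = _
  -- Let d be the diagonal matrix of the deg ψ_a, J = ∂t/∂τ and C = ∂u/∂τ. Then L_E J = Jd - dJ and
  -- L_E C⁻¹ = -dC⁻¹, so the terms JdC⁻¹ cancel and -d remains on the left; with the scalar 1/2 -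
  -- 1/h from √Δ this is μ.
  rw [matDeriv_mul (hJd.mul hCd) (W.matDifferentiableAt_diagonal_sqrtHessian hτ),
    matDeriv_mul hJd hCd, hS, hCinv, matDeriv_polyJacobian_euler, hdeg, hmu, Psi]
  simp only [sub_mul, mul_sub, add_mul, one_mul, mul_one, mul_neg, neg_mul, mul_smul_comm,
    smul_mul_assoc, mul_assoc]
  abel

end SemisimpleChart

/-- The recursion for the coefficients of `R` that expresses homogeneity. -/
theorem IsAsymptoticSolution.recursion {D : HomogeneousBasis T} {F : FlatCoordinates D}
    {W : SemisimpleChart D} {R : Param T → (PowerSeries (Mat T.rank))ˣ}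
    (hR : IsAsymptoticSolution F W R) {τ : Param T} (hτ : τ ∈ W.domain) {B : Mat T.rank}
    (hB : F.IsMulMatrix τ (D.euler τ) B) :
    B * W.Psi F τ = W.Psi F τ * W.U τ ∧ ∀ k : ℕ,
      (k : ℂ) • PowerSeries.coeff k (R τ).val +
          W.U τ * PowerSeries.coeff (k + 1) (R τ).val =
        (W.Psi F τ)⁻¹ * D.mu * W.Psi F τ * PowerSeries.coeff k (R τ).val +
          PowerSeries.coeff (k + 1) (R τ).val * W.U τ := by
  obtain ⟨B', hB', h0, h⟩ := hR.equation τ hτ (D.euler τ)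
  -- The matrix of E• supplied by the equation for R is the given B, so that S and R involve the
  -- same matrix.
  obtain rfl := W.isMulMatrix_unique F hτ hB hB'
  rw [hR.coeff_zero τ hτ, mul_one, W.matDeriv_U_euler hτ] at h0
  refine ⟨h0.symm, fun k => ?_⟩
  have e := h k
  have hd : MatDifferentiableAt (fun σ => PowerSeries.coeff k (R σ).val) τ := fun i j =>
    (hR.differentiableOn k i j).differentiableAt (W.isOpen_domain.mem_nhds hτ)
  -- All derivatives disappear here: L_E Ψ = μΨ, L_E R_k = -kR_k and L_E U = U. Multiplication by
  -- Ψ⁻¹ then gives the recursion.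
  rw [matDeriv_mul (W.matDifferentiableAt_Psi F hτ) hd, W.matDeriv_Psi_euler F hτ,
    eq_neg_of_add_eq_zero_right (hR.homogeneous τ hτ k), W.matDeriv_U_euler hτ, ← mul_assoc B,
    ← h0] at e
  have e' := congr_arg (fun A => (W.Psi F τ)⁻¹ * A) e
  simp only [mul_add, mul_neg, ← mul_assoc, Matrix.nonsing_inv_mul _ (W.isUnit_det_Psi F hτ),
    one_mul] at e'
  rw [← e']
  abel

end SimpleSingularity

end

open SimpleSingularity
theorem proposition6 (T : ADE) (D : HomogeneousBasis T)
    (F : FlatCoordinates D) (W : SemisimpleChart D)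
    (R : Param T → (PowerSeries (Mat T.rank))ˣ)
    (hR : IsAsymptoticSolution F W R)
    (τ : Param T) (hτ : τ ∈ W.domain)
    (S : (PowerSeries (Mat T.rank))ˣ)
    (hS : IsCalibration F τ S) :
    FormalOp.ConjugateDefined
        (transformation F W S R τ)
        (FormalOp.virasoro D.mu) ∧
      FormalOp.conjugate
          (transformation F W S R τ)
          (FormalOp.virasoro D.mu) =
        ∑ i : Fin T.rank, FormalOp.onComponent i
          FormalOp.virasoroA1 := by
  obtain ⟨B, hB, hgauge⟩ := hS.gauge
  obtain ⟨hU, hrec⟩ := hR.recursion hτ hB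
  have hΨ := W.isUnit_det_Psi F hτ
  obtain ⟨d1, c1⟩ := FormalOp.conj_calibration hgauge
  obtain ⟨d2, c2⟩ := FormalOp.conj_const (V := D.mu)
    (V' := (W.Psi F τ)⁻¹ * D.mu * W.Psi F τ) hΨ
    (by rw [mul_assoc, ← mul_assoc, Matrix.mul_nonsing_inv _ hΨ, one_mul]) hU
  obtain ⟨d3, c3⟩ := FormalOp.conj_mulPos (by simp [hR.coeff_zero τ hτ]) hrec
  obtain ⟨d4, c4⟩ := FormalOp.conj_expSeries (W.U τ)
  simp only [transformation, FormalOp.ConjugateDefined, FormalOp.conjugate, c1, c2, c3, c4]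
  exact ⟨⟨d1, d2, d3, d4, trivial⟩, FormalOp.sum_onComponent_virasoroA1.symm⟩
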